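/- Let $q$ be a natural number. A $q$-coloring of a graph $G=(V,E)$ is a family $X=(X_v)_{v\in V}$ of random variables on a common probability space, with values in $\{1,\dots,q\}$, such that almost surely $X_u\neq X_v$ whenever $u$ and $v$ are adjacent. It is $1$-dependent if, for any two sets $A,B\subseteq V$ at graph distance greater than $1$ from each other, the restrictions $(X_v)_{v\in A}$ and $(X_v)_{v\in B}$ are independent. Suppose that $X$ is a $1$-dependent $q$-coloring of $G$ in which the variables $X_v$, $v\in V$, are identically distributed. (i) If $G=\mathbb{Z}^d$ with $d\ge 1$ (the hypercubic lattice, in which $u$ and $v$ are adjacent if and only if $\|u-v\|_1=1$), then $$q\ \ge\ \frac{(d+1)^{d+1}}{d^d};$$ moreover $q\ge 9$ if $d=2$, and $q\ge 12$ if $d=3$. (ii) If $G=T_\Delta$ is the infinite $\Delta$-regular tree, with $\Delta\ge 2$, then $$q\ \ge\ \frac{\Delta^\Delta}{(\Delta-1)^{\Delta-1}}.$$ -/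

import Mathlib

open MeasureTheory ProbabilityTheory

namespace DependentColoring

/-- The hypercubic lattice: vertex set `ℤ ^ d`, with `u` and `v` adjacent when `‖u - v‖₁ = 1`. -/
def hypercubicLattice (d : ℕ) : SimpleGraph (Fin d → ℤ) where
  Adj u v := ∑ i, |u i - v i| = 1
  symm := ⟨fun u v h => by simpa only [abs_sub_comm] using h⟩
  loopless := ⟨fun u h => by simp at h⟩

/-- A `q`-coloring of `G`: a process `X` of random variables indexed by the vertices, with values
in a set of `q` colors, such that almost surely adjacent vertices receive different colors. -/
structure IsColoring {V Ω : Type*} [MeasurableSpace Ω] (G : SimpleGraph V) {q : ℕ}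
    (X : V → Ω → Fin q) (μ : Measure Ω) : Prop where
  measurable : ∀ v, Measurable (X v)
  proper : ∀ u v, G.Adj u v → ∀ᵐ ω ∂μ, X u ω ≠ X v ω

/-- A process indexed by the vertices of `G` is `k`-dependent if its restrictions to any two sets
of vertices at graph distance greater than `k` from each other are independent. The sets may be
infinite, and vertices in different components are at distance `⊤`. -/
def IsDependent {V Ω E : Type*} [MeasurableSpace Ω] [MeasurableSpace E] (G : SimpleGraph V)
    (k : ℕ) (X : V → Ω → E) (μ : Measure Ω) : Prop :=
  ∀ A B : Set V, (∀ a ∈ A, ∀ b ∈ B, (k : ℕ∞) < G.edist a b) →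
    IndepFun (fun ω (a : A) => X a ω) (fun ω (b : B) => X b ω) μ

/-- A `1`-dependent `q`-coloring of `G` in which the colors of the vertices are identically
distributed. -/
structure IsOneDependentIdenticalColoring {V Ω : Type*} [MeasurableSpace Ω] (G : SimpleGraph V)
    {q : ℕ} (X : V → Ω → Fin q) (μ : Measure Ω) : Prop where
  coloring : IsColoring G X μ
  dependent : IsDependent G 1 X μ
  identDistrib : ∀ u v, IdentDistrib (X u) (X v) μ μ

end DependentColoring

/-! ### Avoidance functions of one-dependent hard-core processes. -/

namespace HardCore

open Filter Topology
-- Some colour has probability `p ≥ 1/q` at every vertex, and its vertices form a one-dependent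
-- hard-core process. Let `Q S` be the probability that `S` is empty of that colour. Properness and
-- 1-dependence give `Q (S ∪ {v}) = Q S - p * Q (S \ N(v))`, so `Q` is determined by the graph and
-- `p`, and the question is how large `p` can be while `Q` stays nonnegative.
--
-- Conditional occupation probabilities increase with the set required to be empty (`density_mono`),
-- hence extend to infinite sets as `occ`. For a neighbour `w ∈ A` of `v`, `occ_mul` expresses `occ
-- A v` through the set `A \ {w}`. Applied to all neighbours of `v` in a self-similar set (a branch
-- of the tree, a lexicographic half space of the lattice) it yields `b < 1` with `p ≤ b * (1 - b) ^
-- n`; maximising over `b` gives the general bounds.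
--
-- For `d = 2, 3` these give only 7 and 10. There `occ_mul` is unfolded further along explicit
-- certificates, which turn a lower bound for the half space into a better one. If `p ≥ 1/8`, resp.
-- `p ≥ 1/11`, iteration pushes the bound up to 1, contradicting `occ_lexNeg_lt_one`.
open scoped Classical in
/-- `Q` behaves like the avoidance function `S ↦ P(no vertex of S is occupied)` of a one-dependent
hard-core process on `G` in which every vertex is occupied with probability `p`. -/
structure IsAvoidance {V : Type*} (G : SimpleGraph V) (p : ℝ) (Q : Finset V → ℝ) : Prop where
  empty : Q ∅ = 1
  nonneg : ∀ S, 0 ≤ Q S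
  insert : ∀ v S, v ∉ S → Q (insert v S) = Q S - p * Q (S.filter fun w => ¬ G.Adj v w)
  pos : 0 < p
  exists_boundary : ∀ S : Finset V, S.Nonempty → ∃ v ∈ S, ∃ w ∉ S, G.Adj w v

open scoped Classical in
/-- The probability that `v` is occupied, given that no vertex of `S` is. -/
noncomputable def density {V : Type*} (G : SimpleGraph V) (p : ℝ) (Q : Finset V → ℝ)
    (S : Finset V) (v : V) : ℝ :=
  p * Q (S.filter fun w => ¬ G.Adj v w) / Q S

open scoped Classical in
/-- The probability that `v` is occupied, given that no vertex of the possibly infinite set `A`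
is. -/
noncomputable def occ {V : Type*} (G : SimpleGraph V) (p : ℝ) (Q : Finset V → ℝ)
    (A : Set V) (v : V) : ℝ :=
  ⨆ S : Finset V, density G p Q (S.filter (· ∈ A)) v

namespace IsAvoidance

variable {V : Type*} {G : SimpleGraph V} {p : ℝ} {Q : Finset V → ℝ}

open scoped Classical

/-- At a minimal zero `S`, adding an outside vertex adjacent to `S` would make `Q` negative. -/
theorem Q_pos (h : IsAvoidance G p Q) (S : Finset V) : 0 < Q S := by
  induction S using Finset.strongInduction with
  | H S ih =>
    rcases S.eq_empty_or_nonempty with rfl | hS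
    · rw [h.empty]; exact one_pos
    · refine lt_of_le_of_ne (h.nonneg S) fun h0 => ?_
      obtain ⟨v, hv, w, hw, hvw⟩ := h.exists_boundary S hS
      have h1 := ih (S.filter fun x => ¬ G.Adj w x)
        (Finset.filter_ssubset.2 ⟨v, hv, by simpa using hvw⟩)
      have h2 := h.insert w S hw
      have h3 := h.nonneg (Insert.insert w S)
      have h4 := mul_pos h.pos h1
      linarith

theorem Q_insert_le (h : IsAvoidance G p Q) (S : Finset V) (v : V) :
    Q (Insert.insert v S) ≤ Q S := by
  by_cases hv : v ∈ S
  · rw [Finset.insert_eq_of_mem hv]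
  · rw [h.insert v S hv]
    have := mul_pos h.pos (h.Q_pos (S.filter fun w => ¬ G.Adj v w))
    linarith

theorem Q_antitone (h : IsAvoidance G p Q) : Antitone Q :=
  Finset.antitone_iff_forall_insert_le.2 fun S v _ => h.Q_insert_le S v

theorem Q_insert (h : IsAvoidance G p Q) {S : Finset V} {v : V} (hv : v ∉ S) :
    Q (Insert.insert v S) = Q S * (1 - density G p Q S v) := by
  rw [h.insert v S hv, density, mul_sub, mul_div_cancel₀ _ (h.Q_pos S).ne', mul_one]

theorem density_lt_one (h : IsAvoidance G p Q) {S : Finset V} {v : V} (hv : v ∉ S) :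
    density G p Q S v < 1 := by
  have h1 := h.Q_pos (Insert.insert v S)
  rw [h.Q_insert hv] at h1
  linarith [pos_of_mul_pos_right h1 (h.nonneg S)]

theorem le_density (h : IsAvoidance G p Q) (S : Finset V) (v : V) : p ≤ density G p Q S v := by
  rw [density, le_div_iff₀ (h.Q_pos S)]
  exact mul_le_mul_of_nonneg_left (h.Q_antitone (Finset.filter_subset _ _)) h.pos.le

/-- Add one vertex `u`. If `u` is adjacent to `v`, only the denominator changes, and it decreases.
Otherwise numerator and denominator each gain a factor `1 - density` at `u`, and induction at `u`
compares the two. -/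
theorem density_mono (h : IsAvoidance G p Q) {S T : Finset V} (hST : S ⊆ T) {v : V}
    (hv : v ∉ T) : density G p Q S v ≤ density G p Q T v := by
  induction T using Finset.strongInduction generalizing S v with
  | H T ih =>
    rcases hST.eq_or_ssubset with rfl | hss
    · exact le_rfl
    obtain ⟨u, huT, huS⟩ := Finset.exists_of_ssubset hss
    have hE : T.erase u ⊂ T := Finset.erase_ssubset huT
    have hu : u ∉ T.erase u := Finset.notMem_erase u T
    have hT : T = Insert.insert u (T.erase u) := (Finset.insert_erase huT).symm
    refine (ih _ hE (Finset.subset_erase.2 ⟨hST, huS⟩)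
      (fun hm => hv (Finset.mem_of_mem_erase hm))).trans ?_
    by_cases hadj : G.Adj v u
    · have hF : (T.filter fun w => ¬ G.Adj v w) = (T.erase u).filter fun w => ¬ G.Adj v w := by
        rw [hT, Finset.filter_insert, if_neg (not_not.2 hadj), ← hT]
      rw [density, density, hF]
      exact div_le_div_of_nonneg_left (mul_nonneg h.pos.le (h.nonneg _)) (h.Q_pos _)
        (h.Q_antitone hE.subset)
    · have hF : (T.filter fun w => ¬ G.Adj v w) =
          Insert.insert u ((T.erase u).filter fun w => ¬ G.Adj v w) := by
        rw [hT, Finset.filter_insert, if_pos hadj, ← hT]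
      have hle := ih _ hE (Finset.filter_subset (fun w => ¬ G.Adj v w) _) hu
      have hlt := h.density_lt_one hu
      have hTQ : Q T = Q (T.erase u) * (1 - density G p Q (T.erase u) u) := by
        rw [← h.Q_insert hu, ← hT]
      rw [density, density, hF, h.Q_insert (fun hm => hu (Finset.mem_of_mem_filter u hm)), hTQ,
        div_le_div_iff₀ (h.Q_pos _) (mul_pos (h.Q_pos _) (by linarith))]
      set F := (T.erase u).filter fun w => ¬ G.Adj v w
      have h1 : 0 ≤ p * Q F * Q (T.erase u) :=
        mul_nonneg (mul_nonneg h.pos.le (h.nonneg _)) (h.nonneg _)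
      nlinarith [mul_le_mul_of_nonneg_left hle h1]

/-- An occupied `v` already forces `w` to be empty, so requiring this changes only the
normalisation. -/
theorem density_mul (h : IsAvoidance G p Q) {S : Finset V} {v w : V} (hw : w ∈ S)
    (hadj : G.Adj v w) :
    density G p Q S v * (1 - density G p Q (S.erase w) w) = density G p Q (S.erase w) v := by
  have hF : (S.filter fun x => ¬ G.Adj v x) = (S.erase w).filter fun x => ¬ G.Adj v x := by
    conv_lhs => rw [← Finset.insert_erase hw]
    rw [Finset.filter_insert, if_neg (not_not.2 hadj)]
  have hw' := Finset.notMem_erase w S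
  have hQ : Q S = Q (S.erase w) * (1 - density G p Q (S.erase w) w) := by
    rw [← h.Q_insert hw', Finset.insert_erase hw]
  have h1 := h.density_lt_one hw'
  have h2 : (1 - density G p Q (S.erase w) w) ≠ 0 := by linarith
  have h3 := (h.Q_pos (S.erase w)).ne'
  generalize density G p Q (S.erase w) w = z at *
  rw [density, density, hQ, hF]
  field_simp

theorem bddAbove_density (h : IsAvoidance G p Q) {A : Set V} {v : V} (hv : v ∉ A) :
    BddAbove (Set.range fun S : Finset V => density G p Q (S.filter (· ∈ A)) v) := by
  refine ⟨1, ?_⟩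
  rintro _ ⟨S, rfl⟩
  exact (h.density_lt_one fun hm => hv (Finset.mem_filter.1 hm).2).le

theorem density_le_occ (h : IsAvoidance G p Q) {A : Set V} {v : V} (hv : v ∉ A) {S : Finset V}
    (hS : ∀ w ∈ S, w ∈ A) : density G p Q S v ≤ occ G p Q A v := by
  have := le_ciSup (h.bddAbove_density hv) S
  rwa [Finset.filter_true_of_mem hS] at this

theorem tendsto_occ (h : IsAvoidance G p Q) {A : Set V} {v : V} (hv : v ∉ A) :
    Tendsto (fun S : Finset V => density G p Q (S.filter (· ∈ A)) v) atTop
      (𝓝 (occ G p Q A v)) := by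
  refine tendsto_atTop_ciSup (fun S T hST => ?_) (h.bddAbove_density hv)
  exact h.density_mono (Finset.filter_subset_filter _ hST)
    fun hm => hv (Finset.mem_filter.1 hm).2

theorem le_occ (h : IsAvoidance G p Q) {A : Set V} {v : V} (hv : v ∉ A) :
    p ≤ occ G p Q A v :=
  (h.le_density ∅ v).trans (h.density_le_occ hv (by simp))

theorem occ_mono (h : IsAvoidance G p Q) {A B : Set V} (hAB : A ⊆ B) {v : V} (hv : v ∉ B) :
    occ G p Q A v ≤ occ G p Q B v :=
  ciSup_le fun _ => h.density_le_occ hv fun _ hw => hAB (Finset.mem_filter.1 hw).2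

theorem occ_mul (h : IsAvoidance G p Q) {A : Set V} {v w : V} (hv : v ∉ A) (hw : w ∈ A)
    (hadj : G.Adj v w) :
    occ G p Q A v * (1 - occ G p Q (A \ {w}) w) = occ G p Q (A \ {w}) v := by
  have h1 := (h.tendsto_occ hv).mul
    (tendsto_const_nhds (x := (1 : ℝ)).sub (h.tendsto_occ (A := A \ {w}) (v := w) (by simp)))
  refine tendsto_nhds_unique (h1.congr' ?_)
    (h.tendsto_occ (A := A \ {w}) (v := v) fun hm => hv hm.1)
  filter_upwards [eventually_ge_atTop {w}] with S hS
  have hS' : w ∈ S := hS (Finset.mem_singleton_self w)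
  have : S.filter (· ∈ A \ {w}) = (S.filter (· ∈ A)).erase w := by
    ext x
    simp only [Finset.mem_filter, Set.mem_sdiff, Set.mem_singleton_iff, Finset.mem_erase]
    tauto
  have hd := h.density_mul (Finset.mem_filter.2 ⟨hS', hw⟩) hadj
  rw [← this] at hd
  convert hd

/-- By `occ_mul` for `u` and `A ∪ {v}`, the factor `1 - occ A v` divides a quantity that is at least
`p > 0`. -/
theorem occ_lt_one (h : IsAvoidance G p Q) {A : Set V} {v u : V} (hv : v ∉ A) (hu : u ∉ A)
    (hadj : G.Adj u v) : occ G p Q A v < 1 := by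
  have hA : Insert.insert v A \ {v} = A := by simp [hv]
  have hu' : u ∉ Insert.insert v A := by simp [hu, hadj.ne]
  have h1 := h.occ_mul hu' (Set.mem_insert v A) hadj
  rw [hA] at h1
  have h2 := h.pos.trans_le (h.le_occ hu)
  have h3 := h.pos.trans_le (h.le_occ hu')
  rw [← h1] at h2
  linarith [pos_of_mul_pos_right h2 h3.le]

/-- The recursion determines `Q`, so symmetry is automatic even if the law of the colouring is not
invariant. -/
theorem Q_map (h : IsAvoidance G p Q) (φ : G ≃g G) (S : Finset V) :
    Q (S.map φ.toEquiv.toEmbedding) = Q S := by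
  induction S using Finset.strongInduction with
  | H S ih =>
    rcases S.eq_empty_or_nonempty with rfl | ⟨v, hv⟩
    · simp
    have hE := Finset.erase_ssubset hv
    have hv' := Finset.notMem_erase v S
    have hF : ((S.erase v).map φ.toEquiv.toEmbedding).filter (fun w => ¬ G.Adj (φ v) w) =
        ((S.erase v).filter fun w => ¬ G.Adj v w).map φ.toEquiv.toEmbedding := by
      rw [Finset.filter_map]
      congr 1
      refine Finset.filter_congr fun x _ => ?_
      exact not_congr φ.map_adj_iff
    conv_lhs => rw [← Finset.insert_erase hv, Finset.map_insert]
    conv_rhs => rw [← Finset.insert_erase hv, h.insert v _ hv']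
    have hφ : φ.toEquiv.toEmbedding v ∉ (S.erase v).map φ.toEquiv.toEmbedding := by
      simp
    rw [h.insert _ _ hφ, ih _ hE, ← ih _ ((Finset.filter_subset _ _).trans_ssubset hE)]
    exact congrArg (fun z => Q (S.erase v) - p * Q z) hF

theorem occ_le_occ_of_iso (h : IsAvoidance G p Q) (φ : G ≃g G) {A B : Set V} {v u : V}
    (hAB : ∀ x ∈ A, φ x ∈ B) (hvu : φ v = u) (hu : u ∉ B) : occ G p Q A v ≤ occ G p Q B u := by
  subst hvu
  refine ciSup_le fun S => ?_
  set T := S.filter (· ∈ A) with hT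
  have hF : (T.map φ.toEquiv.toEmbedding).filter (fun w => ¬ G.Adj (φ v) w) =
      (T.filter fun w => ¬ G.Adj v w).map φ.toEquiv.toEmbedding := by
    rw [Finset.filter_map]
    congr 1
    refine Finset.filter_congr fun x _ => ?_
    exact not_congr φ.map_adj_iff
  have h1 : density G p Q T v = density G p Q (T.map φ.toEquiv.toEmbedding) (φ v) := by
    rw [density, density, hF, h.Q_map, h.Q_map]
  rw [h1]
  refine h.density_le_occ hu fun w hw => ?_
  obtain ⟨x, hx, rfl⟩ := Finset.mem_map.1 hw
  exact hAB x (Finset.mem_filter.1 hx).2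

/-- If `A` contains sets `C w`, indexed by neighbours `w` of `v`, and every
`w` is occupied with probability at least `b` given that `C w` is empty, then `v` is occupied with
probability at least `p / (1 - b) ^ n` given that `A` is empty. -/
theorem le_occ_mul_pow (h : IsAvoidance G p Q) {b : ℝ} (hb : b ≤ 1) (C : V → Set V) {v : V}
    (l : List V) {A : Set V} (hv : v ∉ A) (hadj : ∀ w ∈ l, G.Adj v w) (hlA : ∀ w ∈ l, w ∈ A)
    (hCA : ∀ w ∈ l, C w ⊆ A) (hC : ∀ w ∈ l, w ∉ C w) (hbC : ∀ w ∈ l, b ≤ occ G p Q (C w) w)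
    (hl : l.Pairwise fun w w' => w ≠ w' ∧ w ∉ C w') :
    p ≤ occ G p Q A v * (1 - b) ^ l.length := by
  induction l generalizing A with
  | nil => simpa using h.le_occ hv
  | cons w l ih =>
    rw [List.pairwise_cons] at hl
    simp only [List.mem_cons, forall_eq_or_imp] at hadj hlA hCA hC hbC
    have hv' : v ∉ A \ {w} := fun hm => hv hm.1
    have h1 := ih (A := A \ {w}) hv' hadj.2 (fun w' hw' => ⟨hlA.2 w' hw', fun he => (hl.1 w' hw').1 he.symm⟩)
      (fun w' hw' => Set.subset_sdiff_singleton (hCA.2 w' hw') (hl.1 w' hw').2) hC.2 hbC.2 hl.2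
    have h2 : b ≤ occ G p Q (A \ {w}) w := hbC.1.trans
      (h.occ_mono (Set.subset_sdiff_singleton hCA.1 hC.1) (by simp))
    rw [← h.occ_mul hv hlA.1 hadj.1] at h1
    have h3 := h.pos.trans_le (h.le_occ hv)
    have h4 : (0 : ℝ) ≤ (1 - b) ^ l.length := pow_nonneg (by linarith) _
    calc p ≤ _ := h1
      _ ≤ occ G p Q A v * (1 - b) * (1 - b) ^ l.length := by gcongr
      _ = _ := by rw [List.length_cons, pow_succ]; ring

end IsAvoidance

/-- The maximum of `x ↦ (1 - x) x ^ n` on the nonnegative reals. -/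
theorem one_sub_mul_pow_le (n : ℕ) {y : ℝ} (hy : 0 ≤ y) :
    (1 - y) * y ^ n * ((n : ℝ) + 1) ^ (n + 1) ≤ (n : ℝ) ^ n := by
  -- The substitution `t = (n + 1) * y / n` moves the maximiser `y = n / (n + 1)` to `t = 1`.
  have key : ∀ (n : ℕ) (t : ℝ), 0 ≤ t → 0 ≤ n * t ^ (n + 1) - (n + 1) * t ^ n + 1 := by
    intro n t ht
    induction n with
    | zero => simp
    | succ n ih =>
      have h1 : 0 ≤ (t - 1) * (t ^ (n + 1) - 1) := by
        rcases le_total t 1 with h | h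
        · exact mul_nonneg_of_nonpos_of_nonpos (by linarith)
            (by linarith [pow_le_one₀ (n := n + 1) ht h])
        · exact mul_nonneg (by linarith) (by linarith [one_le_pow₀ (n := n + 1) h])
      push_cast
      have h2 := mul_nonneg ht ih
      ring_nf at h1 h2 ⊢
      linarith
  rcases n.eq_zero_or_pos with rfl | hn
  · simpa using hy
  have hn' : (0 : ℝ) < n := by exact_mod_cast hn
  have h1 := key n ((n + 1) * y / n) (by positivity)
  have h2 := mul_nonneg (pow_nonneg hn'.le n) h1
  have h3 : (n : ℝ) ^ n * (n * ((n + 1) * y / n) ^ (n + 1) - (n + 1) * ((n + 1) * y / n) ^ n + 1) =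
      n ^ n - (1 - y) * y ^ n * ((n : ℝ) + 1) ^ (n + 1) := by
    rw [div_pow, div_pow, mul_pow, mul_pow]
    field_simp
    ring
  linarith

end HardCore

/-! ### From colourings to avoidance functions. -/

namespace HardCore

open DependentColoring

section

variable {V Ω : Type*} [MeasurableSpace Ω] {G : SimpleGraph V} {q : ℕ} {X : V → Ω → Fin q}
  {μ : Measure Ω}

theorem measureReal_forall_ne_inter (hG : IsDependent G 1 X μ) {S : Finset V} {v : V} (hv : v ∉ S)
    (hS : ∀ s ∈ S, ¬ G.Adj v s) (c : Fin q) :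
    μ.real ({ω | X v ω = c} ∩ {ω | ∀ s ∈ S, X s ω ≠ c}) =
      μ.real {ω | X v ω = c} * μ.real {ω | ∀ s ∈ S, X s ω ≠ c} := by
  have hind := hG {v} (S : Set V) (by
    rintro a rfl b hb
    rw [← not_le, Nat.cast_one, SimpleGraph.edist_le_one_iff_adj_or_eq]
    rintro (h | rfl)
    · exact hS b hb h
    · exact hv hb)
  have h1 : MeasurableSet {f : ({v} : Set V) → Fin q | f ⟨v, rfl⟩ = c} :=
    (measurable_pi_apply (X := fun _ => Fin q) (⟨v, rfl⟩ : ({v} : Set V)))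
      (measurableSet_singleton c)
  have h2 : MeasurableSet {f : ↥(S : Set V) → Fin q | ∀ s, f s ≠ c} := by
    rw [Set.ofPred_forall]
    exact MeasurableSet.iInter fun s =>
      ((measurable_pi_apply (X := fun _ => Fin q) s) (measurableSet_singleton c)).compl
  have h3 := hind.measure_inter_preimage_eq_mul _ _ h1 h2
  have e1 : (fun ω (a : ({v} : Set V)) => X a ω) ⁻¹' {f | f ⟨v, rfl⟩ = c} = {ω | X v ω = c} := rfl
  have e2 : (fun ω (b : (S : Set V)) => X b ω) ⁻¹' {f | ∀ s, f s ≠ c} =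
      {ω | ∀ s ∈ S, X s ω ≠ c} := by ext; simp
  rw [e1, e2] at h3
  rw [Measure.real, h3, ENNReal.toReal_mul]
  rfl

theorem isAvoidance_measureReal [IsProbabilityMeasure μ]
    (hX : IsOneDependentIdenticalColoring G X μ)
    (hG : ∀ S : Finset V, S.Nonempty → ∃ v ∈ S, ∃ w ∉ S, G.Adj w v) (o : V) (c : Fin q)
    (hc : 0 < μ.real {ω | X o ω = c}) :
    IsAvoidance G (μ.real {ω | X o ω = c}) fun S => μ.real {ω | ∀ s ∈ S, X s ω ≠ c} where
  empty := by simp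
  nonneg _ := measureReal_nonneg
  pos := hc
  exists_boundary := hG
  insert v S hv := by
    classical
    have hmv : MeasurableSet {ω | X v ω = c} :=
      hX.coloring.measurable v (measurableSet_singleton c)
    have hsplit := measureReal_inter_add_sdiff (μ := μ) (s := {ω | ∀ s ∈ S, X s ω ≠ c}) hmv
    have e1 : {ω | ∀ s ∈ S, X s ω ≠ c} \ {ω | X v ω = c} =
        {ω | ∀ s ∈ insert v S, X s ω ≠ c} := by
      ext ω
      simp only [Set.mem_sdiff, Set.mem_ofPred_eq, Finset.forall_mem_insert]
      tauto
    -- When `v` has colour `c`, its neighbours almost surely avoid `c`, so their conditions can be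
    -- dropped; the remaining vertices are independent of `v`.
    have e2 : μ.real ({ω | ∀ s ∈ S, X s ω ≠ c} ∩ {ω | X v ω = c}) =
        μ.real ({ω | X v ω = c} ∩ {ω | ∀ s ∈ S.filter (fun w => ¬ G.Adj v w), X s ω ≠ c}) := by
      refine measureReal_congr ?_
      have hall : ∀ᵐ ω ∂μ, ∀ s ∈ S, G.Adj v s → X v ω ≠ X s ω := by
        refine (Finset.eventually_all S).2 fun s _ => ?_
        by_cases hs : G.Adj v s
        · filter_upwards [hX.coloring.proper v s hs] with ω hω _ using hω
        · exact Filter.Eventually.of_forall fun ω h => absurd h hs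
      filter_upwards [hall] with ω hω
      refine propext ⟨fun h => ⟨h.2, fun s hs => h.1 s (Finset.mem_filter.1 hs).1⟩,
        fun h => ⟨fun s hs => ?_, h.1⟩⟩
      by_cases hadj : G.Adj v s
      · intro h'
        exact hω s hs hadj (Eq.trans h.1 h'.symm)
      · exact h.2 s (Finset.mem_filter.2 ⟨hs, hadj⟩)
    rw [measureReal_forall_ne_inter hX.dependent (fun hm => hv (Finset.mem_filter.1 hm).1)
      (fun s hs => (Finset.mem_filter.1 hs).2)] at e2
    have e3 : μ.real {ω | X v ω = c} = μ.real {ω | X o ω = c} :=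
      congrArg ENNReal.toReal
        ((hX.identDistrib v o).measure_mem_eq (measurableSet_singleton c))
    rw [e1, e2, e3] at hsplit
    convert eq_sub_of_add_eq' hsplit

theorem exists_isAvoidance [IsProbabilityMeasure μ] [Nonempty V]
    (hX : IsOneDependentIdenticalColoring G X μ)
    (hG : ∀ S : Finset V, S.Nonempty → ∃ v ∈ S, ∃ w ∉ S, G.Adj w v) :
    ∃ (p : ℝ) (Q : Finset V → ℝ), 1 ≤ q * p ∧ IsAvoidance G p Q := by
  obtain ⟨o⟩ := ‹Nonempty V›
  have hsum : ∑ c : Fin q, μ.real {ω | X o ω = c} = 1 := by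
    have h := measureReal_biUnion_finset (μ := μ) (s := Finset.univ)
      (f := fun c => {ω | X o ω = c}) (fun a _ b _ hab => Set.disjoint_left.2 fun ω h1 h2 =>
        hab (Eq.trans (Eq.symm h1) h2))
      (fun c _ => hX.coloring.measurable o (measurableSet_singleton c))
    rw [← h]
    have : (⋃ c ∈ (Finset.univ : Finset (Fin q)), {ω | X o ω = c}) = Set.univ := by ext; simp
    rw [this, probReal_univ]
  obtain ⟨c, hc⟩ : ∃ c : Fin q, 1 ≤ q * μ.real {ω | X o ω = c} := by
    by_contra! hlt
    have hne : (Finset.univ : Finset (Fin q)).Nonempty := by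
      by_contra hne
      rw [Finset.not_nonempty_iff_eq_empty.1 hne] at hsum
      simp at hsum
    have h1 := Finset.sum_lt_sum_of_nonempty hne fun c _ => hlt c
    rw [← Finset.mul_sum, hsum] at h1
    simp at h1
  refine ⟨_, _, hc, isAvoidance_measureReal hX hG o c ?_⟩
  refine measureReal_nonneg.lt_of_ne fun h0 => ?_
  rw [← h0] at hc
  norm_num at hc

end

theorem div_le_of_le_one_sub_mul_pow {n q : ℕ} {p x : ℝ} (hn : 0 < n) (hx : x ≤ 1)
    (hpq : 1 ≤ q * p) (hp : p ≤ x * (1 - x) ^ n) :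
    ((n : ℝ) + 1) ^ (n + 1) / (n : ℝ) ^ n ≤ q := by
  have h1 := one_sub_mul_pow_le n (y := 1 - x) (by linarith)
  rw [sub_sub_cancel] at h1
  have hn' : (0 : ℝ) < (n : ℝ) ^ n := by positivity
  rw [div_le_iff₀ hn']
  calc ((n : ℝ) + 1) ^ (n + 1) ≤ (q * p) * ((n : ℝ) + 1) ^ (n + 1) :=
        le_mul_of_one_le_left (by positivity) hpq
    _ ≤ q * (x * (1 - x) ^ n) * ((n : ℝ) + 1) ^ (n + 1) := by gcongr
    _ = q * (x * (1 - x) ^ n * ((n : ℝ) + 1) ^ (n + 1)) := by ring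
    _ ≤ q * (n : ℝ) ^ n := by gcongr

end HardCore

/-! ### Regular trees. -/

namespace HardCore

open DependentColoring

section Tree

variable {V : Type*} {T : SimpleGraph V}

/-- The vertices `x ≠ v` that are separated from `u` by the vertex `v`, for an edge `u v` of a
tree. -/
def branch (T : SimpleGraph V) (u v : V) : Set V :=
  {x | x ≠ v ∧ T.dist x u = T.dist x v + 1}

/-- Paths in a tree are unique, so only one neighbour of `v` can be closer to `x` than `v` is. -/
theorem dist_eq_add_one_of_tree (hT : T.IsTree) {u v w x : V} (huv : T.Adj u v)
    (hvw : T.Adj v w) (huw : u ≠ w) (hx : T.dist x v = T.dist x w + 1) :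
    T.dist x u = T.dist x v + 1 := by
  rcases hT.dist_eq_dist_add_one_of_adj x huv with h | h
  · exact h
  exfalso
  have hpath : ∀ y, T.Adj y v → T.dist x v = T.dist x y + 1 →
      ∃ p : T.Walk x v, p.IsPath ∧ p.penultimate = y := by
    intro y hy hd
    obtain ⟨p, hp⟩ := hT.connected.exists_walk_length_eq_dist x y
    refine ⟨p.concat hy, (p.concat hy).isPath_of_length_eq_dist ?_, ?_⟩
    · rw [SimpleGraph.Walk.length_concat, hp, hd]
    · simp
  obtain ⟨p, hp, rfl⟩ := hpath u huv h
  obtain ⟨r, hr, rfl⟩ := hpath w hvw.symm hx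
  exact huw (congrArg _ ((hT.existsUnique_path x v).unique hp hr))

theorem infinite_of_isTree [T.LocallyFinite] {Δ : ℕ} (hΔ : 2 ≤ Δ) (hT : T.IsTree)
    (hreg : T.IsRegularOfDegree Δ) : Infinite V := by
  classical
  by_contra hfin
  rw [not_infinite_iff_finite] at hfin
  have := Fintype.ofFinite V
  obtain ⟨v⟩ := hT.connected.nonempty
  have hv := hreg v
  obtain ⟨w, hw⟩ : (T.neighborFinset v).Nonempty := by
    rw [← Finset.card_pos, SimpleGraph.card_neighborFinset_eq_degree]
    lia
  have : Nontrivial V := ⟨v, w, ((T.mem_neighborFinset v w).1 hw).ne⟩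
  obtain ⟨u, hu⟩ := hT.exists_vert_degree_one_of_nontrivial
  have h2 := hreg u
  have : T.degree u = Δ := by convert h2
  simp only [← SimpleGraph.card_neighborFinset_eq_degree] at *
  have : 1 = Δ := by rw [← h2, ← hu]; congr!
  lia

theorem exists_boundary_of_connected [Infinite V] (hT : T.Connected) (S : Finset V)
    (hS : S.Nonempty) : ∃ v ∈ S, ∃ w ∉ S, T.Adj w v := by
  obtain ⟨a, ha⟩ := hS
  obtain ⟨b, hb⟩ := Infinite.exists_notMem_finset S
  obtain ⟨p⟩ := hT a b
  obtain ⟨d, -, h1, h2⟩ := p.exists_boundary_dart (S : Set V) ha hb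
  exact ⟨d.fst, h1, d.snd, h2, d.adj.symm⟩

/-- Each branch contains `Δ - 1` sub-branches. Taking `b` to be the infimum over all directed edges
closes the recursion without using automorphisms of the tree. -/
theorem IsAvoidance.exists_le_of_isTree [T.LocallyFinite] {Δ : ℕ} (hΔ : 2 ≤ Δ) (hT : T.IsTree)
    (hreg : T.IsRegularOfDegree Δ) {p : ℝ} {Q : Finset V → ℝ} (h : IsAvoidance T p Q) :
    ∃ b ≤ 1, p ≤ b * (1 - b) ^ (Δ - 1) := by
  classical
  have hdeg : ∀ v, (T.neighborFinset v).card = Δ := fun v => by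
    rw [SimpleGraph.card_neighborFinset_eq_degree]; exact hreg v
  let f : T.Dart → ℝ := fun e => occ T p Q (branch T e.fst e.snd) e.snd
  have hbr : ∀ u v, v ∉ branch T u v := fun u v hv => hv.1 rfl
  have hbr' : ∀ u v, u ∉ branch T u v := fun u v hu => by
    have := hu.2
    rw [SimpleGraph.dist_self] at this
    lia
  have hlt : ∀ e, f e < 1 := fun e => h.occ_lt_one (hbr _ _) (hbr' _ _) e.adj
  have hbdd : BddBelow (Set.range f) := ⟨p, by rintro _ ⟨e, rfl⟩; exact h.le_occ (hbr _ _)⟩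
  have hne : Nonempty T.Dart := by
    obtain ⟨v⟩ := hT.connected.nonempty
    obtain ⟨w, hw⟩ : (T.neighborFinset v).Nonempty := by
      rw [← Finset.card_pos, hdeg]
      lia
    exact ⟨⟨(v, w), (T.mem_neighborFinset v w).1 hw⟩⟩
  set b := ⨅ e, f e with hb
  have hb1 : b < 1 := (ciInf_le hbdd hne.some).trans_lt (hlt _)
  have hpow : 0 < (1 - b) ^ (Δ - 1) := pow_pos (by linarith) _
  refine ⟨b, hb1.le, ?_⟩
  rw [← div_le_iff₀ hpow]
  refine le_ciInf fun e => ?_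
  obtain ⟨⟨u, v⟩, huv⟩ := e
  replace huv : T.Adj u v := huv
  rw [div_le_iff₀ hpow]
  set l := ((T.neighborFinset v).erase u).toList with hl
  have hmem : ∀ w ∈ l, T.Adj v w ∧ u ≠ w := by
    intro w hw
    rw [hl, Finset.mem_toList, Finset.mem_erase, SimpleGraph.mem_neighborFinset] at hw
    exact ⟨hw.2, hw.1.symm⟩
  have hlen : l.length = Δ - 1 := by
    rw [hl, Finset.length_toList, Finset.card_erase_of_mem
      ((T.mem_neighborFinset v u).2 huv.symm), hdeg]
  have hdist : ∀ w ∈ l, T.dist w v = 1 := fun w hw =>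
    SimpleGraph.dist_eq_one_iff_adj.2 (hmem w hw).1.symm
  rw [← hlen]
  refine h.le_occ_mul_pow hb1.le (fun w => branch T v w) l (hbr u v) (fun w hw => (hmem w hw).1)
    (fun w hw => ⟨(hmem w hw).1.ne', ?_⟩) (fun w hw x hx => ⟨?_, ?_⟩) (fun w _ => hbr v w)
    (fun w hw => ciInf_le hbdd (⟨(v, w), (hmem w hw).1⟩ : T.Dart)) ?_
  · exact dist_eq_add_one_of_tree hT huv (hmem w hw).1 (hmem w hw).2
      (by rw [hdist w hw, SimpleGraph.dist_self])
  · rintro rfl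
    exact hbr' x w hx
  · exact dist_eq_add_one_of_tree hT huv (hmem w hw).1 (hmem w hw).2 hx.2
  · have hnd : l.Pairwise (· ≠ ·) := Finset.nodup_toList _
    refine hnd.imp_of_mem fun {w w'} hw _ hww' => ⟨hww', fun hm => hww' ?_⟩
    have h1 := hm.2
    rw [hdist w hw] at h1
    exact (hT.connected.dist_eq_zero_iff).1 (by lia)

theorem le_of_isTree {Ω : Type*} [MeasurableSpace Ω] {μ : Measure Ω} [IsProbabilityMeasure μ]
    {q : ℕ} [T.LocallyFinite] {Δ : ℕ} (hΔ : 2 ≤ Δ) (hT : T.IsTree)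
    (hreg : T.IsRegularOfDegree Δ) {X : V → Ω → Fin q}
    (hX : IsOneDependentIdenticalColoring T X μ) :
    (Δ : ℝ) ^ Δ / ((Δ : ℝ) - 1) ^ (Δ - 1) ≤ q := by
  have := infinite_of_isTree hΔ hT hreg
  have := hT.connected.nonempty
  obtain ⟨p, Q, hpq, h⟩ := exists_isAvoidance hX (exists_boundary_of_connected hT.connected)
  obtain ⟨b, hb, hp⟩ := h.exists_le_of_isTree hΔ hT hreg
  have := div_le_of_le_one_sub_mul_pow (by lia) hb hpq hp
  rwa [Nat.cast_sub (by lia), Nat.sub_add_cancel (by lia), Nat.cast_one, sub_add_cancel] at this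

end Tree

end HardCore

/-! ### The lexicographic half space of the lattice. -/

namespace HardCore

open DependentColoring

section Lattice

variable {d : ℕ}

/-- The last nonzero coordinate of `x` exists and is negative. -/
def LexNeg (x : Fin d → ℤ) : Prop := ∃ i, x i < 0 ∧ ∀ j, i < j → x j = 0

instance : DecidablePred (LexNeg (d := d)) := fun x =>
  inferInstanceAs (Decidable (∃ i, x i < 0 ∧ ∀ j, i < j → x j = 0))

theorem not_lexNeg_zero : ¬ LexNeg (0 : Fin d → ℤ) := by
  rintro ⟨i, hi, -⟩
  exact lt_irrefl _ hi

theorem LexNeg.add {x y : Fin d → ℤ} (hx : LexNeg x) (hy : LexNeg y) : LexNeg (x + y) := by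
  obtain ⟨i, hi, hi'⟩ := hx
  obtain ⟨j, hj, hj'⟩ := hy
  rcases lt_trichotomy i j with h | rfl | h
  · exact ⟨j, by simpa [hi' j h] using hj, fun k hk => by simp [hi' k (h.trans hk), hj' k hk]⟩
  · exact ⟨i, by simpa using add_neg hi hj, fun k hk => by simp [hi' k hk, hj' k hk]⟩
  · exact ⟨i, by simpa [hj' i h] using hi, fun k hk => by simp [hi' k hk, hj' k (h.trans hk)]⟩

theorem not_lexNeg_of_pos {x : Fin d → ℤ} {i : Fin d} (hi : 0 < x i)
    (hi' : ∀ j, i < j → x j = 0) : ¬ LexNeg x := by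
  rintro ⟨j, hj, hj'⟩
  rcases lt_trichotomy i j with h | rfl | h
  · exact hj.ne (hi' j h)
  · exact hi.not_gt hj
  · exact hi.ne' (hj' i h)

theorem lexNeg_neg_single (i : Fin d) : LexNeg (-Pi.single i 1 : Fin d → ℤ) :=
  ⟨i, by simp, fun j hj => by simp [Pi.single_eq_of_ne hj.ne']⟩

theorem hypercubicLattice_adj {u v : Fin d → ℤ} :
    (hypercubicLattice d).Adj u v ↔ ∑ i, |u i - v i| = 1 := Iff.rfl

theorem adj_add_single (v : Fin d → ℤ) (i : Fin d) {s : ℤ} (hs : |s| = 1) :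
    (hypercubicLattice d).Adj v (v + Pi.single i s) := by
  rw [hypercubicLattice_adj, Finset.sum_eq_single i]
  · simpa using hs
  · intro j _ hj
    simp [Pi.single_eq_of_ne hj]
  · simp

/-- Translations of the lattice. -/
def translation (t : Fin d → ℤ) : hypercubicLattice d ≃g hypercubicLattice d where
  toEquiv := Equiv.addLeft t
  map_rel_iff' {u v} := by simp [hypercubicLattice]

theorem translation_apply (t x : Fin d → ℤ) : translation t x = t + x := rfl

/-- Reversing the sign of every coordinate but the last. -/
def reflect (x : Fin (d + 1) → ℤ) : Fin (d + 1) → ℤ :=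
  fun i => if i = Fin.last d then x i else -x i

theorem reflect_reflect (x : Fin (d + 1) → ℤ) : reflect (reflect x) = x := by
  ext i
  simp only [reflect]
  split_ifs <;> simp

/-- `reflect` as an automorphism of the lattice. -/
def reflection (d : ℕ) : hypercubicLattice (d + 1) ≃g hypercubicLattice (d + 1) where
  toEquiv := Function.Involutive.toPerm reflect reflect_reflect
  map_rel_iff' {u v} := by
    have habs : ∀ i, |reflect u i - reflect v i| = |u i - v i| := by
      intro i
      simp only [reflect]
      split_ifs
      · rfl
      · rw [neg_sub_neg, abs_sub_comm]
    exact iff_of_eq (congrArg (· = 1) (Finset.sum_congr rfl fun i _ => habs i))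

theorem reflection_apply (x : Fin (d + 1) → ℤ) : reflection d x = reflect x := rfl

theorem exists_boundary_lattice (S : Finset (Fin (d + 1) → ℤ)) (hS : S.Nonempty) :
    ∃ v ∈ S, ∃ w ∉ S, (hypercubicLattice (d + 1)).Adj w v := by
  obtain ⟨v, hv, hmax⟩ := S.exists_max_image (fun x => x 0) hS
  refine ⟨v, hv, v + Pi.single 0 1, fun hm => ?_, (adj_add_single v 0 (by simp)).symm⟩
  have := hmax _ hm
  simp at this

namespace IsAvoidance

theorem occ_lexNeg_lt_one {p : ℝ} {Q : Finset (Fin (d + 1) → ℤ) → ℝ}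
    (h : IsAvoidance (hypercubicLattice (d + 1)) p Q) :
    occ (hypercubicLattice (d + 1)) p Q {x | LexNeg x} 0 < 1 := by
  refine h.occ_lt_one (u := Pi.single 0 1) not_lexNeg_zero
    (not_lexNeg_of_pos (i := 0) (by simp) fun j hj => by simp [Pi.single_eq_of_ne hj.ne']) ?_
  simpa using (adj_add_single 0 0 (by simp)).symm

/-- The half space contains the neighbours `-eᵢ` of 0, each with its own translated half space, on
which `occ` is at least that of the original. -/
theorem le_occ_lexNeg_mul_pow {p : ℝ} {Q : Finset (Fin (d + 1) → ℤ) → ℝ}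
    (h : IsAvoidance (hypercubicLattice (d + 1)) p Q) :
    p ≤ occ (hypercubicLattice (d + 1)) p Q {x | LexNeg x} 0 *
      (1 - occ (hypercubicLattice (d + 1)) p Q {x | LexNeg x} 0) ^ (d + 1) := by
  set l : List (Fin (d + 1) → ℤ) := (List.finRange (d + 1)).map fun i => -Pi.single i 1 with hl
  have hlen : l.length = d + 1 := by simp [hl]
  have hmem : ∀ w ∈ l, ∃ i, w = -Pi.single i 1 := by
    intro w hw
    obtain ⟨i, -, rfl⟩ := List.mem_map.1 hw
    exact ⟨i, rfl⟩
  have key := h.le_occ_mul_pow h.occ_lexNeg_lt_one.le (fun w => {x | LexNeg (x - w)}) l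
    (v := 0) (A := {x | LexNeg x}) not_lexNeg_zero ?_ ?_ ?_ ?_ ?_ ?_
  · rwa [hlen] at key
  · intro w hw
    obtain ⟨i, rfl⟩ := hmem w hw
    have := adj_add_single (0 : Fin (d + 1) → ℤ) i (s := -1) (by simp)
    rwa [zero_add, Pi.single_neg] at this
  · intro w hw
    obtain ⟨i, rfl⟩ := hmem w hw
    exact lexNeg_neg_single i
  · intro w hw x hx
    obtain ⟨i, rfl⟩ := hmem w hw
    have := LexNeg.add hx (lexNeg_neg_single i)
    rwa [sub_add_cancel] at this
  · intro w _ hw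
    change LexNeg (w - w) at hw
    rw [sub_self] at hw
    exact not_lexNeg_zero hw
  · intro w _
    refine h.occ_le_occ_of_iso (translation w) (fun x hx => ?_)
      ((translation_apply w 0).trans (add_zero w)) fun hm => not_lexNeg_zero (d := d + 1) ?_
    · rw [translation_apply, Set.mem_ofPred_eq, add_sub_cancel_left]
      exact hx
    · rwa [Set.mem_ofPred_eq, sub_self] at hm
  -- For `i < j` the last nonzero coordinate of `eⱼ - eᵢ` is positive, so `-eᵢ` is outside the half
  -- space at `-eⱼ`.
  · rw [hl, List.pairwise_map]
    refine (List.pairwise_lt_finRange (d + 1)).imp fun {i j} hij => ⟨fun he => ?_, ?_⟩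
    · have := congrFun he i
      simp [Pi.single_eq_of_ne hij.ne] at this
    · refine not_lexNeg_of_pos (i := j) ?_ fun k hk => ?_
      · simp [Pi.single_eq_of_ne hij.ne']
      · simp [Pi.single_eq_of_ne hk.ne', Pi.single_eq_of_ne (hij.trans hk).ne']

end IsAvoidance

/-! ### Certificates for numerical lower bounds. -/

/-- Instructions for bounding `occ ({x | LexNeg x} \ R) v` from below: use the trivial bound, use
an isometric copy of the half space, or remove the neighbour of `v` in direction `± eᵢ` from the
set, treating that neighbour by the first certificate and what remains by the second. -/
inductive Cert (d : ℕ) : Type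
  | base : Cert d
  | half : Cert d
  | branch : Fin d → Bool → Cert d → Cert d → Cert d

namespace Cert

/-- The vertex reached from `v` by a step in direction `± eᵢ`. -/
def step (v : Fin d → ℤ) (i : Fin d) (b : Bool) : Fin d → ℤ :=
  v + Pi.single i (if b then 1 else -1)

/-- Whether the instructions can be followed at the vertex `v` with the set `R` removed. -/
def valid : Cert (d + 1) → List (Fin (d + 1) → ℤ) → (Fin (d + 1) → ℤ) → Bool
  | base, _, _ => true
  | half, R, v =>
    decide (LexNeg v) && R.all (fun r => !decide (LexNeg (r - v))) ||
      decide (v (Fin.last d) < 0) && R.all fun r => !decide (LexNeg (reflect (r - v)))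
  | branch i b c c', R, v =>
    decide (LexNeg (step v i b)) && R.all (fun r => !decide (r = step v i b)) &&
      c.valid (step v i b :: R) (step v i b) && c'.valid (step v i b :: R) v

/-- The lower bound that a certificate yields, in units of `1 / N`, when `p ≥ 1 / m` and the
half space has the lower bound `x`. -/
def value (N m x : ℕ) : Cert d → ℕ
  | base => N / m
  | half => x
  | branch _ _ c c' => c'.value N m x * N / (N - c.value N m x)

/-- A branch is `occ_mul` solved for `occ A v`; natural-number division rounds down, hence to the
safe side. -/
theorem value_le_occ {p : ℝ} {Q : Finset (Fin (d + 1) → ℤ) → ℝ}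
    (h : IsAvoidance (hypercubicLattice (d + 1)) p Q) {N m x : ℕ} (hm : 1 ≤ m * p)
    (hx : (x : ℝ) ≤ N * occ (hypercubicLattice (d + 1)) p Q {x | LexNeg x} 0)
    (c : Cert (d + 1)) (R : List (Fin (d + 1) → ℤ)) (v : Fin (d + 1) → ℤ)
    (hv : v ∉ {x | LexNeg x} \ {x | x ∈ R}) (hc : c.valid R v = true) :
    (c.value N m x : ℝ) ≤
      N * occ (hypercubicLattice (d + 1)) p Q ({x | LexNeg x} \ {x | x ∈ R}) v := by
  induction c generalizing R v with
  | base =>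
    refine le_trans ?_ (mul_le_mul_of_nonneg_left (h.le_occ hv) N.cast_nonneg)
    have hm0 : (0 : ℝ) < m := by
      by_contra hle
      have : m * p ≤ 0 := mul_nonpos_of_nonpos_of_nonneg (not_lt.1 hle) h.pos.le
      linarith
    refine Nat.cast_div_le.trans ?_
    rw [div_le_iff₀ hm0]
    nlinarith [mul_le_mul_of_nonneg_left hm (Nat.cast_nonneg (α := ℝ) N)]
  | half =>
    refine hx.trans (mul_le_mul_of_nonneg_left ?_ N.cast_nonneg)
    simp only [valid, Bool.or_eq_true, Bool.and_eq_true, decide_eq_true_eq, List.all_eq_true,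
      Bool.not_eq_true', decide_eq_false_iff_not] at hc
    rcases hc with ⟨hv', hR⟩ | ⟨hv', hR⟩
    · refine h.occ_le_occ_of_iso (translation v) (fun x hx => ?_)
        ((translation_apply v 0).trans (add_zero v)) hv
      rw [translation_apply]
      exact ⟨hv'.add hx, fun hr => hR _ hr (by rwa [add_sub_cancel_left])⟩
    -- The reflected half space has last coordinate at most 0; translation by `v` makes it negative.
    · refine h.occ_le_occ_of_iso ((reflection d).trans (translation v)) (fun x hx => ?_) ?_ hv
      · rw [RelIso.trans_apply, translation_apply, reflection_apply]
        refine ⟨⟨Fin.last d, ?_, fun j hj => absurd hj (Fin.le_last j).not_gt⟩,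
          fun hr => hR _ hr (by rwa [add_sub_cancel_left, reflect_reflect])⟩
        obtain ⟨i, hi, hi'⟩ := hx
        have : x (Fin.last d) ≤ 0 := by
          rcases (Fin.le_last i).eq_or_lt with rfl | hlt
          · exact hi.le
          · exact (hi' _ hlt).le
        simp only [Pi.add_apply, reflect, if_true]
        linarith
      · rw [RelIso.trans_apply, translation_apply, reflection_apply]
        ext i
        simp [reflect]
  | branch i b c c' ihc ihc' =>
    simp only [valid, Bool.and_eq_true, decide_eq_true_eq, List.all_eq_true,
      Bool.not_eq_true', decide_eq_false_iff_not] at hc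
    obtain ⟨⟨⟨hw, hwR⟩, hc1⟩, hc2⟩ := hc
    set w := step v i b with hwdef
    set A : Set (Fin (d + 1) → ℤ) := {x | LexNeg x} \ {x | x ∈ R} with hA
    have hA' : {x | LexNeg x} \ {x | x ∈ w :: R} = A \ {w} := by
      ext y
      simp only [hA, List.mem_cons, Set.mem_sdiff, Set.mem_ofPred_eq, Set.mem_singleton_iff]
      tauto
    have hwA : w ∈ A := ⟨hw, fun hr => hwR w hr rfl⟩
    have hadj : (hypercubicLattice (d + 1)).Adj v w :=
      adj_add_single v i (by cases b <;> simp)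
    have h1 := ihc (w :: R) w (by rw [hA']; simp) hc1
    have h2 := ihc' (w :: R) v (by rw [hA']; exact fun hm => hv hm.1) hc2
    rw [hA'] at h1 h2
    rw [← h.occ_mul hv hwA hadj] at h2
    have h3 := h.pos.le.trans (h.le_occ hv)
    simp only [value]
    generalize c.value N m x = k at *
    generalize c'.value N m x = j at *
    rcases le_or_gt N k with hk | hk
    -- Here the denominator truncates to 0 and the value is 0, a trivial bound.
    · rw [Nat.sub_eq_zero_of_le hk, Nat.div_zero, Nat.cast_zero]
      positivity
    · refine Nat.cast_div_le.trans ?_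
      have hk' : (0 : ℝ) < N - k := sub_pos.2 (by exact_mod_cast hk)
      rw [Nat.cast_sub hk.le, div_le_iff₀ hk', Nat.cast_mul]
      have hN := Nat.cast_nonneg (α := ℝ) N
      calc (j : ℝ) * N ≤ N * (occ _ p Q A v * (1 - occ _ p Q (A \ {w}) w)) * N := by gcongr
        _ = N * occ _ p Q A v * (N - N * occ _ p Q (A \ {w}) w) := by ring
        _ ≤ N * occ _ p Q A v * (N - k) := by gcongr

/-- Bootstrapping from the bound 0: each entry of `xs` is justified by the one before it, and the
last would make the occupation probability at least 1. -/
theorem not_isAvoidance (c : Cert (d + 1)) (hc : c.valid [] 0 = true) {N m : ℕ} (hN : 0 < N)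
    (xs : List ℕ) (hne : xs ≠ []) (hxs : (0 :: xs).IsChain fun x y => y ≤ c.value N m x)
    (hlast : N ≤ xs.getLast hne) {p : ℝ} (hm : 1 ≤ m * p) {Q : Finset (Fin (d + 1) → ℤ) → ℝ} :
    ¬ IsAvoidance (hypercubicLattice (d + 1)) p Q := by
  intro h
  have hall : ∀ (xs : List ℕ) (x : ℕ),
      (x : ℝ) ≤ N * occ (hypercubicLattice (d + 1)) p Q {x | LexNeg x} 0 →
      (x :: xs).IsChain (fun x y => y ≤ c.value N m x) → ∀ y ∈ xs,
      (y : ℝ) ≤ N * occ (hypercubicLattice (d + 1)) p Q {x | LexNeg x} 0 := by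
    intro xs
    induction xs with
    | nil => simp
    | cons y ys ih =>
      intro x hx hch
      rw [List.isChain_cons_cons] at hch
      have hv : (0 : Fin (d + 1) → ℤ) ∉ {x | LexNeg x} \ {x | x ∈ ([] : List (Fin (d + 1) → ℤ))} :=
        fun hm => not_lexNeg_zero hm.1
      have h1 := c.value_le_occ h hm hx [] 0 hv hc
      have hy : (y : ℝ) ≤ N * occ (hypercubicLattice (d + 1)) p Q {x | LexNeg x} 0 := by
        refine le_trans (by exact_mod_cast hch.1) (h1.trans_eq ?_)
        simp
      exact List.forall_mem_cons.2 ⟨hy, ih y hy hch.2⟩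
  have h0 := h.pos.le.trans (h.le_occ (A := {x | LexNeg x}) not_lexNeg_zero)
  have h1 := hall xs 0 (by rw [Nat.cast_zero]; positivity) hxs _ (List.getLast_mem hne)
  have h2 := h.occ_lexNeg_lt_one
  have h3 : (N : ℝ) ≤ xs.getLast hne := by exact_mod_cast hlast
  have hN' : (0 : ℝ) < N := by exact_mod_cast hN
  nlinarith

end Cert

end Lattice

end HardCore

/-! ### The square and cubic lattices. -/

namespace HardCore

open DependentColoring

namespace Cert

/-- Explores `n` rows of the square lattice below a vertex. -/
def descend : ℕ → Cert 2
  | 0 => half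
  | n + 1 => branch 0 false half (branch 0 true half (branch 1 false (descend n) base))

/-- A certificate for the square lattice. -/
def square : Cert 2 :=
  branch 0 false half <| branch 1 false
    (branch 0 false
      (branch 0 false
        (branch 0 false half (branch 1 false (descend 4) (branch 1 true base base)))
        (branch 1 false (descend 4) base))
      (branch 0 true half (branch 1 false (descend 5) base)))
    base

/-- Explores one layer of the cubic lattice around a vertex, with `c` for the vertex below. -/
def layer (c : Cert 3) : Cert 3 :=
  branch 1 true half <| branch 0 true
    (branch 1 true half <| branch 0 true base <| branch 1 false half <| branch 2 false half base) <|
    branch 0 false half <| branch 1 false half <| branch 2 false c base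

/-- A certificate for the cubic lattice. -/
def cube : Cert 3 :=
  branch 0 false half <| branch 1 false half <| branch 2 false (layer (layer half)) base

theorem square_valid : square.valid [] 0 = true := by decide +kernel

theorem cube_valid : cube.valid [] 0 = true := by decide +kernel

theorem not_isAvoidance_square {p : ℝ} (hp : 1 ≤ 8 * p) {Q : Finset (Fin 2 → ℤ) → ℝ} :
    ¬ IsAvoidance (hypercubicLattice 2) p Q :=
  -- Successive lower bounds in units of `1 / N`; the final step jumps to probability 1.
  square.not_isAvoidance square_valid (N := 100000) (m := 8) (by norm_num)
    [15200, 19370, 21204, 22220, 22867, 23319, 23659, 23926, 24146, 24334, 24501, 24650,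
      24790, 24923, 25054, 25184, 25318, 25457, 25606, 25772, 25961, 26187, 26466, 26833,
      27356, 28199, 29886, 32231, 100000] (by simp) (by decide +kernel) (by simp)
    (by exact_mod_cast hp)

theorem not_isAvoidance_cube {p : ℝ} (hp : 1 ≤ 11 * p) {Q : Finset (Fin 3 → ℤ) → ℝ} :
    ¬ IsAvoidance (hypercubicLattice 3) p Q :=
  cube.not_isAvoidance cube_valid (N := 10000) (m := 11) (by norm_num)
    [1023, 1363, 1534, 1638, 1712, 1767, 1812, 1850, 1885, 1919, 1951, 1985, 2022, 2064,
      2115, 2180, 2271, 2419, 2727, 3113, 10000] (by simp) (by decide +kernel) (by simp)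
    (by exact_mod_cast hp)

end Cert

theorem lattice_bounds {Ω : Type*} [MeasurableSpace Ω] {μ : Measure Ω} [IsProbabilityMeasure μ]
    {q d : ℕ} {X : (Fin (d + 1) → ℤ) → Ω → Fin q}
    (hX : IsOneDependentIdenticalColoring (hypercubicLattice (d + 1)) X μ) :
    ((d : ℝ) + 1 + 1) ^ (d + 1 + 1) / ((d : ℝ) + 1) ^ (d + 1) ≤ q ∧
      (d = 1 → 9 ≤ q) ∧ (d = 2 → 12 ≤ q) := by
  obtain ⟨p, Q, hpq, h⟩ := exists_isAvoidance hX exists_boundary_lattice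
  have hlt : ∀ n : ℕ, q ≤ n → 1 ≤ n * p := fun n hn =>
    hpq.trans (mul_le_mul_of_nonneg_right (by exact_mod_cast hn) h.pos.le)
  refine ⟨?_, ?_, ?_⟩
  · have := div_le_of_le_one_sub_mul_pow d.succ_pos h.occ_lexNeg_lt_one.le hpq
      h.le_occ_lexNeg_mul_pow
    exact_mod_cast this
  -- The dimension is `d + 1`, so `d = 1` is the square lattice.
  · rintro rfl
    by_contra hq
    exact Cert.not_isAvoidance_square (by exact_mod_cast hlt 8 (by lia)) h
  · rintro rfl
    by_contra hq
    exact Cert.not_isAvoidance_cube (by exact_mod_cast hlt 11 (by lia)) h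

end HardCore

theorem proposition1p7 {Ω : Type*} [MeasurableSpace Ω] (μ : Measure Ω) [IsProbabilityMeasure μ]
    (q : ℕ) :
    (∀ (d : ℕ), 1 ≤ d → ∀ X : (Fin d → ℤ) → Ω → Fin q,
      DependentColoring.IsOneDependentIdenticalColoring
        (DependentColoring.hypercubicLattice d) X μ →
      ((d : ℝ) + 1) ^ (d + 1) / (d : ℝ) ^ d ≤ (q : ℝ) ∧
        (d = 2 → 9 ≤ q) ∧ (d = 3 → 12 ≤ q)) ∧
    (∀ {V : Type*} (T : SimpleGraph V) [T.LocallyFinite] (Δ : ℕ), 2 ≤ Δ →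
      T.IsTree → T.IsRegularOfDegree Δ → ∀ X : V → Ω → Fin q,
      DependentColoring.IsOneDependentIdenticalColoring T X μ →
      (Δ : ℝ) ^ Δ / ((Δ : ℝ) - 1) ^ (Δ - 1) ≤ (q : ℝ)) := by
  refine ⟨fun d hd X hX => ?_, fun T _ Δ hΔ hT hreg X hX => HardCore.le_of_isTree hΔ hT hreg hX⟩
  obtain ⟨d, rfl⟩ := Nat.exists_eq_add_of_le' hd
  obtain ⟨h1, h2, h3⟩ := HardCore.lattice_bounds hX
  exact ⟨by exact_mod_cast h1, fun h => h2 (by lia), fun h => h3 (by lia)⟩
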